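/- Let $N\in\mathbf N$, $\mathbf T^N=\mathbf R^N/\mathbf Z^N$ (functions on $\mathbf T^N$ are identified with $\mathbf Z^N$-periodic functions on $\mathbf R^N$), and let $|\cdot|$ be the Euclidean norm. Let $\sigma:\mathbf T^N\to(0,\infty)$ be continuous, and let $m:[0,\infty)\to(0,1)$ be Lipschitz continuous and strictly increasing with $m(r)\to1$ as $r\to\infty$. Put $\overline\sigma=\sup_{\mathbf T^N}\sigma$, $\underline\sigma=\inf_{\mathbf T^N}\sigma$, $m_0=m(0)$ and $H(x,p)=\sigma(x)\,m(|p|)$. For $u\in C(\mathbf T^N)$ let $D^+u(x)$ (resp. $D^-u(x)$) be the set of all $D\phi(x)$ with $\phi\in C^1(\mathbf T^N)$ such that $u-\phi$ attains its maximum (resp. minimum) over $\mathbf T^N$ at $x$. For $P\in\mathbf R^N$, a pair $(u,a)$ with $u:\mathbf T^N\to\mathbf R$ Lipschitz continuous and $a\in\mathbf R$ is a solution of the cell problem $$H(x,Du(x)+P)=a\quad\text{in }\mathbf T^N$$ if it is one in the viscosity sense: for every $x$, $H(x,p+P)\le a$ for all $p\in D^+u(x)$ and $H(x,p+P)\ge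 a$ for all $p\in D^-u(x)$. Let $\mathcal D$ be the set of all $P\in\mathbf R^N$ for which the cell problem has a solution $(u,a)$. Theorem. Assume $\overline\sigma m_0<\underline\sigma$. Let $P\in\mathbf R^N$ and assume that there exists $\psi\in C^1(\mathbf T^N)$ such that $D\psi=-P$ on $\{\sigma\ne\underline\sigma\}$. Then $P\in\mathcal D$, that is, the cell problem is solvable at $P$. -/

import Mathlib

open Filter Topology
open scoped NNReal

/-- Functions on the torus `ℝᴺ / ℤᴺ` are regarded as `ℤᴺ`-periodic functions on `ℝᴺ`:
`u (x + z) = u x` for all `x ∈ ℝᴺ` and `z ∈ ℤᴺ`. -/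
def TorusPeriodic {N : ℕ} (u : EuclideanSpace ℝ (Fin N) → ℝ) : Prop :=
  ∀ (x : EuclideanSpace ℝ (Fin N)) (z : Fin N → ℤ),
    u (x + WithLp.toLp 2 (fun i => (z i : ℝ))) = u x

/-- The superdifferential `D⁺u(x)`: gradients at `x` of the test functions `φ ∈ C¹(𝕋ᴺ)` for which
`u - φ` attains its maximum over the torus at `x`. -/
def superdifferential {N : ℕ} (u : EuclideanSpace ℝ (Fin N) → ℝ)
    (x : EuclideanSpace ℝ (Fin N)) : Set (EuclideanSpace ℝ (Fin N)) :=
  {p | ∃ φ : EuclideanSpace ℝ (Fin N) → ℝ, TorusPeriodic φ ∧ ContDiff ℝ 1 φ ∧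
    (∀ y, u y - φ y ≤ u x - φ x) ∧ gradient φ x = p}

/-- The subdifferential `D⁻u(x)`: gradients at `x` of the test functions `φ ∈ C¹(𝕋ᴺ)` for which
`u - φ` attains its minimum over the torus at `x`. -/
def subdifferential {N : ℕ} (u : EuclideanSpace ℝ (Fin N) → ℝ)
    (x : EuclideanSpace ℝ (Fin N)) : Set (EuclideanSpace ℝ (Fin N)) :=
  {p | ∃ φ : EuclideanSpace ℝ (Fin N) → ℝ, TorusPeriodic φ ∧ ContDiff ℝ 1 φ ∧
    (∀ y, u x - φ x ≤ u y - φ y) ∧ gradient φ x = p}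

/-- `u ∈ C(𝕋ᴺ)` is a viscosity subsolution of `F(x, Du(x)) = 0` in `𝕋ᴺ`. -/
def IsViscositySubsolution {N : ℕ}
    (F : EuclideanSpace ℝ (Fin N) → EuclideanSpace ℝ (Fin N) → ℝ)
    (u : EuclideanSpace ℝ (Fin N) → ℝ) : Prop :=
  TorusPeriodic u ∧ Continuous u ∧ ∀ x, ∀ p ∈ superdifferential u x, F x p ≤ 0

/-- `u ∈ C(𝕋ᴺ)` is a viscosity supersolution of `F(x, Du(x)) = 0` in `𝕋ᴺ`. -/
def IsViscositySupersolution {N : ℕ}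
    (F : EuclideanSpace ℝ (Fin N) → EuclideanSpace ℝ (Fin N) → ℝ)
    (u : EuclideanSpace ℝ (Fin N) → ℝ) : Prop :=
  TorusPeriodic u ∧ Continuous u ∧ ∀ x, ∀ p ∈ subdifferential u x, 0 ≤ F x p

/-- `u ∈ C(𝕋ᴺ)` is a viscosity solution of `F(x, Du(x)) = 0` in `𝕋ᴺ`. -/
def IsViscositySolution {N : ℕ}
    (F : EuclideanSpace ℝ (Fin N) → EuclideanSpace ℝ (Fin N) → ℝ)
    (u : EuclideanSpace ℝ (Fin N) → ℝ) : Prop :=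
  IsViscositySubsolution F u ∧ IsViscositySupersolution F u

/-- `(u, a) ∈ Lip(𝕋ᴺ) × ℝ` is a solution of the cell problem `H(x, Du(x) + P) = a` in `𝕋ᴺ`. -/
def IsCellSolution {N : ℕ}
    (H : EuclideanSpace ℝ (Fin N) → EuclideanSpace ℝ (Fin N) → ℝ)
    (P : EuclideanSpace ℝ (Fin N)) (u : EuclideanSpace ℝ (Fin N) → ℝ) (a : ℝ) : Prop :=
  (∃ K : ℝ≥0, LipschitzWith K u) ∧ IsViscositySolution (fun x p => H x (p + P) - a) u

/-- The solvability set `𝒟` of the cell problem for `H`. -/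
def solvabilitySet {N : ℕ}
    (H : EuclideanSpace ℝ (Fin N) → EuclideanSpace ℝ (Fin N) → ℝ) :
    Set (EuclideanSpace ℝ (Fin N)) :=
  {P | ∃ (u : EuclideanSpace ℝ (Fin N) → ℝ) (a : ℝ), IsCellSolution H P u a}

-- `ψ` is a strict subsolution below the level `s = inf σ`. Where `σ ≠ s`, `Dψ + P = 0` and `H ≤
-- (sup σ) * m 0 < s`; where `σ = s`, `H = s * m |Dψ + P|`, and by compactness its supremum is below
-- `s`. So `H(x, Dψ + P) ≤ a < s` for some `a`. Although `H` is bounded, it is coercive below any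
-- level `b < s`: `H < b` forces `m < b / s < 1`, which bounds the gradient.
--
-- This suffices for the vanishing discount method (`exists_ergodic_solution`). Perron's method
-- solves `λ u + H = 0` above `ψ - M - a / λ`, where `|ψ| ≤ M`, so only levels below `b` matter and
-- a single Lipschitz constant `K` serves for all `λ` (`exists_discounted_solution`). Limits of `u -
-- u 0` and `-λ u 0` as `λ → 0` solve the cell problem by stability
-- (`IsDiscountedSubsolution.of_tendsto`).

local notation "𝔼" N => EuclideanSpace ℝ (Fin N)

/-! ### Periodic functions and compactness of the torus. -/

/-- The lattice vector with integer coordinates `z`. -/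
def latticeVec {N : ℕ} (z : Fin N → ℤ) : 𝔼 N := WithLp.toLp 2 (fun i => (z i : ℝ))

/-- The closed unit cube, a compact set of representatives of the torus. -/
def unitCube (N : ℕ) : Set (𝔼 N) := WithLp.toLp 2 '' Set.Icc (0 : Fin N → ℝ) 1

theorem isCompact_unitCube (N : ℕ) : IsCompact (unitCube N) :=
  isCompact_Icc.image (PiLp.continuous_toLp 2 _)

theorem exists_add_latticeVec_mem_unitCube {N : ℕ} (x : 𝔼 N) :
    ∃ z : Fin N → ℤ, x + latticeVec z ∈ unitCube N := by
  refine ⟨fun i => -⌊x i⌋, fun i => Int.fract (x i), ⟨fun i => Int.fract_nonneg _,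
    fun i => (Int.fract_lt_one _).le⟩, ?_⟩
  ext i
  simp [latticeVec, Int.fract, sub_eq_add_neg]

namespace TorusPeriodic

variable {N : ℕ} {u v : (𝔼 N) → ℝ}

theorem eq (h : TorusPeriodic u) (x : 𝔼 N) (z : Fin N → ℤ) : u (x + latticeVec z) = u x := h x z

theorem exists_forall_le (h : TorusPeriodic u) (hc : Continuous u) :
    ∃ x ∈ unitCube N, ∀ y, u y ≤ u x := by
  have hne : (unitCube N).Nonempty :=
    let ⟨z, hz⟩ := exists_add_latticeVec_mem_unitCube (0 : 𝔼 N)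
    ⟨_, hz⟩
  obtain ⟨x, hx, hmax⟩ := (isCompact_unitCube N).exists_isMaxOn hne hc.continuousOn
  refine ⟨x, hx, fun y => ?_⟩
  obtain ⟨z, hz⟩ := exists_add_latticeVec_mem_unitCube y
  rw [← h.eq y z]
  exact hmax hz

theorem add (hu : TorusPeriodic u) (hv : TorusPeriodic v) :
    TorusPeriodic fun x => u x + v x := fun x z => by simp only [hu x z, hv x z]

theorem sub (hu : TorusPeriodic u) (hv : TorusPeriodic v) :
    TorusPeriodic fun x => u x - v x := fun x z => by simp only [hu x z, hv x z]

theorem neg (hu : TorusPeriodic u) : TorusPeriodic fun x => -u x :=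
  fun x z => by simp only [hu x z]

theorem const (c : ℝ) : TorusPeriodic (N := N) fun _ => c := fun _ _ => rfl

theorem max (hu : TorusPeriodic u) (hv : TorusPeriodic v) :
    TorusPeriodic fun x => Max.max (u x) (v x) := fun x z => by simp only [hu x z, hv x z]

theorem gradient (hu : TorusPeriodic u) (x : 𝔼 N) (z : Fin N → ℤ) :
    gradient u (x + latticeVec z) = gradient u x := by
  have : (fun y => u (y + latticeVec z)) = u := funext fun y => hu.eq y z
  unfold _root_.gradient
  rw [← fderiv_comp_add_right, this]

theorem of_tendsto {ι : Type*} {l : Filter ι} [l.NeBot] {w : ι → (𝔼 N) → ℝ}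
    (hw : ∀ i, TorusPeriodic (w i)) (h : ∀ x, Tendsto (fun i => w i x) l (𝓝 (u x))) :
    TorusPeriodic u := fun x z =>
  tendsto_nhds_unique (h _) ((h x).congr fun i => (hw i x z).symm)

end TorusPeriodic

/-! ### Calculus of gradients. -/

section Gradient

variable {F : Type*} [NormedAddCommGroup F] [InnerProductSpace ℝ F] [CompleteSpace F]
  {f g : F → ℝ} {x : F}

theorem gradient_add (hf : DifferentiableAt ℝ f x) (hg : DifferentiableAt ℝ g x) :
    gradient (fun y => f y + g y) x = gradient f x + gradient g x := by
  simp [gradient, fderiv_fun_add hf hg]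

theorem gradient_neg : gradient (fun y => -f y) x = -gradient f x := by
  simp [gradient]

theorem gradient_add_const (c : ℝ) : gradient (fun y => f y + c) x = gradient f x := by
  simp [gradient]

theorem norm_gradient : ‖gradient f x‖ = ‖fderiv ℝ f x‖ := by
  simp [gradient]

theorem continuous_gradient (hf : ContDiff ℝ 1 f) : Continuous (gradient f) :=
  (InnerProductSpace.toDual ℝ F).symm.continuous.comp (hf.continuous_fderiv one_ne_zero)

theorem gradient_eq_of_forall_sub_le (hf : DifferentiableAt ℝ f x) (hg : DifferentiableAt ℝ g x)
    (h : ∀ y, f y - g y ≤ f x - g x) : gradient f x = gradient g x := by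
  have h0 : fderiv ℝ (fun y => f y - g y) x = 0 :=
    IsLocalMax.fderiv_eq_zero (Eventually.of_forall h)
  rw [fderiv_fun_sub hf hg, sub_eq_zero] at h0
  simp [gradient, h0]

end Gradient

/-! ### A periodic penalty in place of `|x - x₀|²`. -/

section Penalty

variable {N : ℕ}

/-- A smooth periodic function vanishing exactly on the lattice translate through `x₀`. -/
noncomputable def torusPenalty (x₀ x : 𝔼 N) : ℝ :=
  ∑ i, (1 - Real.cos (2 * Real.pi * (x i - x₀ i)))

theorem torusPenalty_nonneg (x₀ x : 𝔼 N) : 0 ≤ torusPenalty x₀ x :=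
  Finset.sum_nonneg fun _ _ => sub_nonneg.2 (Real.cos_le_one _)

@[simp] theorem torusPenalty_self (x₀ : 𝔼 N) : torusPenalty x₀ x₀ = 0 := by
  simp [torusPenalty]

theorem contDiff_torusPenalty (x₀ : 𝔼 N) : ContDiff ℝ 1 (torusPenalty x₀) := by
  unfold torusPenalty
  fun_prop

theorem torusPeriodic_torusPenalty (x₀ : 𝔼 N) : TorusPeriodic (torusPenalty x₀) := by
  intro x z
  refine Finset.sum_congr rfl fun i _ => ?_
  rw [← Real.cos_add_int_mul_two_pi (2 * Real.pi * (x i - x₀ i)) (z i)]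
  congr 2
  simp
  ring

theorem exists_eq_add_latticeVec_of_torusPenalty_nonpos {x₀ x : 𝔼 N}
    (h : torusPenalty x₀ x ≤ 0) : ∃ z : Fin N → ℤ, x = x₀ + latticeVec z := by
  have h0 := (Finset.sum_eq_zero_iff_of_nonneg fun i (_ : i ∈ Finset.univ) =>
    sub_nonneg.2 (Real.cos_le_one (2 * Real.pi * (x i - x₀ i)))).1
      (le_antisymm h (torusPenalty_nonneg x₀ x))
  have h1 : ∀ i, ∃ n : ℤ, x i = x₀ i + n := fun i => by
    obtain ⟨n, hn⟩ := (Real.cos_eq_one_iff _).1 (sub_eq_zero.1 (h0 i (Finset.mem_univ i))).symm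
    refine ⟨n, ?_⟩
    have : (n : ℝ) = x i - x₀ i := by
      have := Real.pi_pos
      apply mul_right_cancel₀ (b := 2 * Real.pi) (by positivity)
      linarith
    linarith
  choose z hz using h1
  exact ⟨z, by ext i; simpa [latticeVec] using hz i⟩

theorem gradient_torusPenalty_self (x₀ : 𝔼 N) : gradient (torusPenalty x₀) x₀ = 0 := by
  have : fderiv ℝ (torusPenalty x₀) x₀ = 0 := IsLocalMin.fderiv_eq_zero <|
    Eventually.of_forall fun y => by simpa using torusPenalty_nonneg x₀ y
  simp [gradient, this]

/-- On the compact set `unitCube N \ s` the penalty has a positive minimum. -/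
theorem exists_torusPenalty_lt_imp {s : Set (𝔼 N)} (hs : IsOpen s) (x₀ : 𝔼 N) (hx₀ : x₀ ∈ s)
    (hper : ∀ x z, x + latticeVec z ∈ s ↔ x ∈ s) :
    ∃ δ > 0, ∀ x, torusPenalty x₀ x < δ → x ∈ s := by
  have hcont := (contDiff_torusPenalty x₀).continuous
  rcases (unitCube N \ s).eq_empty_or_nonempty with he | hne
  · refine ⟨1, one_pos, fun x _ => ?_⟩
    obtain ⟨z, hz⟩ := exists_add_latticeVec_mem_unitCube x
    exact (hper x z).1 (Set.sdiff_eq_empty.1 he hz)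
  · obtain ⟨y, hy, hmin⟩ := ((isCompact_unitCube N).diff hs).exists_isMinOn hne hcont.continuousOn
    refine ⟨torusPenalty x₀ y, ?_, fun x hx => ?_⟩
    · by_contra! hle
      obtain ⟨z, rfl⟩ := exists_eq_add_latticeVec_of_torusPenalty_nonpos hle
      exact hy.2 ((hper x₀ z).2 hx₀)
    · by_contra hxs
      obtain ⟨z, hz⟩ := exists_add_latticeVec_mem_unitCube x
      have := hmin ⟨hz, fun h => hxs ((hper x z).1 h)⟩
      rw [Set.mem_ofPred_eq, (torusPeriodic_torusPenalty x₀).eq] at this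
      exact hx.not_ge this

end Penalty

theorem Ultrafilter.exists_tendsto_of_mem_compact {ι X : Type*} [TopologicalSpace X]
    (U : Ultrafilter ι) {s : Set X} (hs : IsCompact s) {f : ι → X} (hf : ∀ i, f i ∈ s) :
    ∃ a ∈ s, Tendsto f U (𝓝 a) :=
  hs.ultrafilter_le_nhds' (U.map f) (Filter.mem_map.2 (Filter.univ_mem' hf))

/-! ### Discounted equations and stability of viscosity solutions. -/

section Viscosity

variable {N : ℕ}

/-- `F(x, Du) ≤ c - λ u` in the viscosity sense. -/
def IsDiscountedSubsolution (F : (𝔼 N) → (𝔼 N) → ℝ) (lam c : ℝ) (u : (𝔼 N) → ℝ) : Prop :=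
  ∀ x, ∀ p ∈ superdifferential u x, F x p ≤ c - lam * u x

/-- `F(x, Du) ≥ c - λ u` in the viscosity sense. -/
def IsDiscountedSupersolution (F : (𝔼 N) → (𝔼 N) → ℝ) (lam c : ℝ) (u : (𝔼 N) → ℝ) : Prop :=
  ∀ x, ∀ p ∈ subdifferential u x, c - lam * u x ≤ F x p

theorem neg_mem_superdifferential_neg {u : (𝔼 N) → ℝ} {x p : 𝔼 N} :
    -p ∈ superdifferential (fun y => -u y) x ↔ p ∈ subdifferential u x := by
  constructor
  · rintro ⟨φ, hper, hφ, hle, hg⟩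
    exact ⟨fun y => -φ y, hper.neg, hφ.neg, fun y => by linarith [hle y],
      by rw [gradient_neg, hg, neg_neg]⟩
  · rintro ⟨φ, hper, hφ, hle, hg⟩
    exact ⟨fun y => -φ y, hper.neg, hφ.neg, fun y => by linarith [hle y],
      by rw [gradient_neg, hg]⟩

theorem isDiscountedSupersolution_iff_neg {F : (𝔼 N) → (𝔼 N) → ℝ} {lam c : ℝ}
    {u : (𝔼 N) → ℝ} : IsDiscountedSupersolution F lam c u ↔
      IsDiscountedSubsolution (fun x p => -F x (-p)) lam (-c) (fun x => -u x) := by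
  constructor
  · intro h x p hp
    rw [← neg_neg p, neg_mem_superdifferential_neg] at hp
    linarith [h x _ hp]
  · intro h x p hp
    have := h x _ (neg_mem_superdifferential_neg.2 hp)
    simp only [neg_neg] at this
    linarith

theorem superdifferential_subset_of_le {u v : (𝔼 N) → ℝ} {x : 𝔼 N} (h : ∀ y, v y ≤ u y)
    (hx : v x = u x) : superdifferential u x ⊆ superdifferential v x := by
  rintro p ⟨φ, hper, hφ, hle, hg⟩
  exact ⟨φ, hper, hφ, fun y => by linarith [hle y, h y], hg⟩

theorem eq_gradient_of_mem_superdifferential {u : (𝔼 N) → ℝ} {x p : 𝔼 N}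
    (hu : DifferentiableAt ℝ u x) (hp : p ∈ superdifferential u x) : p = gradient u x := by
  obtain ⟨φ, -, hφ, hle, rfl⟩ := hp
  exact (gradient_eq_of_forall_sub_le hu (hφ.differentiable one_ne_zero x) hle).symm

/-- The penalty makes the touching point unique modulo the lattice, so maximizers for `v i` converge
to a translate of `x₀`. The common Lipschitz constant lets pointwise convergence pass to moving
points. -/
theorem IsDiscountedSubsolution.of_tendsto {ι : Type*} (U : Ultrafilter ι)
    {F : (𝔼 N) → (𝔼 N) → ℝ} (hF : Continuous (Function.uncurry F))
    (hFper : ∀ x z p, F (x + latticeVec z) p = F x p) {K : ℝ≥0} {v : ι → (𝔼 N) → ℝ}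
    {w : (𝔼 N) → ℝ} {lam c : ι → ℝ} {lam₀ c₀ : ℝ} (hper : ∀ i, TorusPeriodic (v i))
    (hlip : ∀ i, LipschitzWith K (v i)) (hsub : ∀ i, IsDiscountedSubsolution F (lam i) (c i) (v i))
    (hv : ∀ x, Tendsto (fun i => v i x) U (𝓝 (w x))) (hlam : Tendsto lam U (𝓝 lam₀))
    (hc : Tendsto c U (𝓝 c₀)) : IsDiscountedSubsolution F lam₀ c₀ w := by
  rintro x₀ p ⟨φ, hφper, hφ, hle, rfl⟩
  have hq := contDiff_torusPenalty x₀
  have hqper := torusPeriodic_torusPenalty x₀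
  set θ : (𝔼 N) → ℝ := fun y => φ y + torusPenalty x₀ y with hθ_def
  have hθ : ContDiff ℝ 1 θ := hφ.add hq
  have hθper : TorusPeriodic θ := hφper.add hqper
  have hmax : ∀ i, ∃ x ∈ unitCube N, ∀ y, v i y - θ y ≤ v i x - θ x := fun i =>
    ((hper i).sub hθper).exists_forall_le ((hlip i).continuous.sub hθ.continuous)
  choose x hx hxmax using hmax
  obtain ⟨a, -, ha⟩ := U.exists_tendsto_of_mem_compact (isCompact_unitCube N) hx
  have hva : Tendsto (fun i => v i (x i)) U (𝓝 (w a)) := by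
    have h0 : Tendsto (fun i => v i (x i) - v i a) U (𝓝 0) := by
      refine squeeze_zero_norm (a := fun i => K * dist (x i) a) (fun i => ?_) ?_
      · rw [← dist_eq_norm]
        exact (hlip i).dist_le_mul _ _
      · simpa using (tendsto_iff_dist_tendsto_zero.1 ha).const_mul (K : ℝ)
    simpa using h0.add (hv a)
  have hamax : ∀ y, w y - θ y ≤ w a - θ a := fun y =>
    le_of_tendsto_of_tendsto' ((hv y).sub_const _)
      (hva.sub ((hθ.continuous.tendsto a).comp ha)) fun i => hxmax i y
  have hqa : torusPenalty x₀ a ≤ 0 := by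
    have h1 := hamax x₀
    have h2 := hle a
    simp only [hθ_def, torusPenalty_self] at h1
    linarith
  obtain ⟨z, rfl⟩ := exists_eq_add_latticeVec_of_torusPenalty_nonpos hqa
  have hlim : Tendsto (fun i => F (x i) (gradient θ (x i))) U
      (𝓝 (F (x₀ + latticeVec z) (gradient θ (x₀ + latticeVec z)))) :=
    (hF.tendsto _).comp (ha.prodMk_nhds (((continuous_gradient hθ).tendsto _).comp ha))
  have key := le_of_tendsto_of_tendsto' hlim (hc.sub (hlam.mul hva)) fun i =>
    hsub i (x i) _ ⟨θ, hθper, hθ, hxmax i, rfl⟩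
  have hw : TorusPeriodic w := TorusPeriodic.of_tendsto hper hv
  rwa [hFper, hθper.gradient, hw.eq, gradient_add (hφ.differentiable one_ne_zero _)
    (hq.differentiable one_ne_zero _), gradient_torusPenalty_self, add_zero] at key

theorem IsDiscountedSupersolution.of_tendsto {ι : Type*} (U : Ultrafilter ι)
    {F : (𝔼 N) → (𝔼 N) → ℝ} (hF : Continuous (Function.uncurry F))
    (hFper : ∀ x z p, F (x + latticeVec z) p = F x p) {K : ℝ≥0} {v : ι → (𝔼 N) → ℝ}
    {w : (𝔼 N) → ℝ} {lam c : ι → ℝ} {lam₀ c₀ : ℝ} (hper : ∀ i, TorusPeriodic (v i))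
    (hlip : ∀ i, LipschitzWith K (v i))
    (hsup : ∀ i, IsDiscountedSupersolution F (lam i) (c i) (v i))
    (hv : ∀ x, Tendsto (fun i => v i x) U (𝓝 (w x))) (hlam : Tendsto lam U (𝓝 lam₀))
    (hc : Tendsto c U (𝓝 c₀)) : IsDiscountedSupersolution F lam₀ c₀ w := by
  rw [isDiscountedSupersolution_iff_neg]
  refine IsDiscountedSubsolution.of_tendsto U ?_ (fun x z p => by rw [hFper])
    (fun i => (hper i).neg) (fun i => (hlip i).neg)
    (fun i => isDiscountedSupersolution_iff_neg.1 (hsup i)) (fun x => (hv x).neg) hlam hc.neg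
  exact (hF.comp (continuous_fst.prodMk continuous_snd.neg)).neg

end Viscosity

/-- Along a segment starting where `u < f`, the mean value inequality applies until `f` first meets
`u`; from there the bound for `u` takes over. -/
theorem LipschitzWith.max_of_norm_fderiv_le {E : Type*} [NormedAddCommGroup E] [NormedSpace ℝ E]
    {K : ℝ≥0} {u f : E → ℝ} (hu : LipschitzWith K u) (hf : Differentiable ℝ f)
    (h : ∀ x, u x < f x → ‖fderiv ℝ f x‖ ≤ K) : LipschitzWith K fun x => max (u x) (f x) := by
  refine LipschitzWith.of_le_add_mul K fun x y => ?_
  have huxy : ∀ a b, u a ≤ u b + K * dist a b := hu.le_add_mul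
  rcases le_or_gt (f x) (u x) with hx | hx
  · rw [max_eq_left hx]
    exact (huxy x y).trans (add_le_add_left (le_max_left _ _) _)
  rw [max_eq_right hx.le]
  set γ : ℝ → E := fun t => x + t • (y - x) with hγ
  have hγc : Continuous γ := by fun_prop
  have hγd : ∀ t, HasDerivAt γ (y - x) t := fun t => by
    simpa [hγ] using ((hasDerivAt_id t).smul_const (y - x)).const_add x
  have hγ1 : γ 1 = y := by simp [hγ]
  have hγ0 : γ 0 = x := by simp [hγ]
  -- Adjoining `1` covers the case where `f` stays above `u` up to the endpoint.
  have hclosed : IsClosed ({1} ∪ {t | f (γ t) ≤ u (γ t)}) :=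
    isClosed_singleton.union
      (isClosed_le (hf.continuous.comp hγc) (hu.continuous.comp hγc))
  obtain ⟨t₀, ⟨ht₀, ht₀'⟩, hmin⟩ := (isCompact_Icc.inter_right hclosed).exists_isLeast
    (s := Set.Icc (0 : ℝ) 1 ∩ _) ⟨1, by simp, by simp⟩
  have hgt : ∀ t ∈ Set.Ico 0 t₀, u (γ t) < f (γ t) := fun t ht => by
    by_contra! hle
    exact (hmin ⟨⟨ht.1, ht.2.le.trans ht₀.2⟩, Or.inr hle⟩).not_gt ht.2
  have hder : ∀ t, HasDerivAt (fun s => f (γ s)) (fderiv ℝ f (γ t) (y - x)) t := fun t =>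
    (hf (γ t)).hasFDerivAt.comp_hasDerivAt t (hγd t)
  have hmv := norm_image_sub_le_of_norm_deriv_le_segment' (a := 0) (b := t₀)
    (C := K * ‖y - x‖) (fun t _ => (hder t).hasDerivWithinAt)
    (fun t ht => (ContinuousLinearMap.le_opNorm _ _).trans
      (mul_le_mul_of_nonneg_right (h _ (hgt t ht)) (norm_nonneg _))) t₀ ⟨ht₀.1, le_rfl⟩
  rw [hγ0, sub_zero, Real.norm_eq_abs, abs_sub_comm] at hmv
  have h1 := (le_abs_self _).trans hmv
  rw [dist_comm, dist_eq_norm]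
  rcases ht₀' with rfl | hle
  · rw [hγ1] at h1
    linarith [le_max_right (u y) (f y)]
  · have h2 := huxy (γ t₀) y
    have h3 : dist (γ t₀) y = (1 - t₀) * ‖y - x‖ := by
      have : y - γ t₀ = (1 - t₀) • (y - x) := by simp only [hγ]; module
      rw [dist_comm, dist_eq_norm, this, norm_smul, Real.norm_of_nonneg (sub_nonneg.2 ht₀.2)]
    rw [h3] at h2
    have hle' : f (γ t₀) ≤ u (γ t₀) := hle
    linarith [le_max_left (u y) (f y)]

/-! ### Perron's method within the `K`-Lipschitz subsolutions. -/

section Perron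

variable {N : ℕ} {F : (𝔼 N) → (𝔼 N) → ℝ} {lam c : ℝ} {K : ℝ≥0}

theorem IsDiscountedSubsolution.nonpos (hF : ∀ x p, 0 ≤ F x p) (hlam : 0 < lam)
    {v : (𝔼 N) → ℝ} (hper : TorusPeriodic v) (hc : Continuous v)
    (hv : IsDiscountedSubsolution F lam 0 v) (x : 𝔼 N) : v x ≤ 0 := by
  obtain ⟨a, -, ha⟩ := hper.exists_forall_le hc
  have h1 := hv a _ ⟨fun _ => 0, TorusPeriodic.const 0, contDiff_const, fun y => by
    simpa using ha y, rfl⟩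
  have h2 : lam * v a ≤ 0 := by linarith [hF a (gradient (fun _ : 𝔼 N => (0 : ℝ)) a)]
  exact (ha x).trans (nonpos_of_mul_nonpos_right h2 hlam)

/-- An ultrafilter limit of members nearly optimal at `x₀` is a subsolution lying below `u` and
touching it at `x₀`, so it inherits the test functions of `u` there. -/
theorem isDiscountedSubsolution_of_isLUB (hF : Continuous (Function.uncurry F))
    (hFper : ∀ x z p, F (x + latticeVec z) p = F x p) {S : Set ((𝔼 N) → ℝ)}
    (hper : ∀ v ∈ S, TorusPeriodic v) (hlip : ∀ v ∈ S, LipschitzWith K v)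
    (hsub : ∀ v ∈ S, IsDiscountedSubsolution F lam c v) (hne : S.Nonempty) {u : (𝔼 N) → ℝ}
    (hu : ∀ x, IsLUB ((fun v => v x) '' S) (u x)) : IsDiscountedSubsolution F lam c u := by
  intro x₀ p hp
  obtain ⟨s, -, -, hs, hmem⟩ := (hu x₀).exists_seq_monotone_tendsto (hne.image _)
  choose v hvS hvs using hmem
  set U : Ultrafilter ℕ := hyperfilter ℕ
  have hvu : ∀ n x, v n x ≤ u x := fun n x => (hu x).1 ⟨v n, hvS n, rfl⟩
  have hs' : Tendsto (fun n => v n x₀) U (𝓝 (u x₀)) :=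
    (hs.mono_left Nat.hyperfilter_le_atTop).congr fun n => (hvs n).symm
  have hlim : ∀ x, ∃ a, Tendsto (fun n => v n x) U (𝓝 a) := fun x => by
    obtain ⟨b, hb⟩ := hs.bddBelow_range
    obtain ⟨a, -, ha⟩ := U.exists_tendsto_of_mem_compact
      (isCompact_Icc (a := b - K * dist x₀ x) (b := u x)) (f := fun n => v n x) fun n => by
        refine ⟨?_, hvu n x⟩
        have h1 : b ≤ v n x₀ := (hb ⟨n, rfl⟩).trans_eq (hvs n).symm
        linarith [(hlip _ (hvS n)).le_add_mul x₀ x]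
    exact ⟨a, ha⟩
  choose w hw using hlim
  have hwx₀ : w x₀ = u x₀ := tendsto_nhds_unique (hw x₀) hs'
  have hwu : ∀ y, w y ≤ u y := fun y => le_of_tendsto' (hw y) fun n => hvu n y
  rw [← hwx₀]
  exact IsDiscountedSubsolution.of_tendsto U hF hFper (fun n => hper _ (hvS n))
    (fun n => hlip _ (hvS n)) (fun n => hsub _ (hvS n)) hw tendsto_const_nhds tendsto_const_nhds
    x₀ p (superdifferential_subset_of_le hwu hwx₀ hp)

/-- If the supersolution test fails at `x₀`, a raised test function can be glued onto `u`; the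
strict bound on `p` persists nearby and keeps the bump `K`-Lipschitz. -/
theorem exists_bump_subsolution (hF : Continuous (Function.uncurry F))
    (hFper : ∀ x z p, F (x + latticeVec z) p = F x p) (hlam : 0 < lam) {u : (𝔼 N) → ℝ}
    (hper : TorusPeriodic u) (hlip : LipschitzWith K u) (hu : IsDiscountedSubsolution F lam c u)
    {x₀ p : 𝔼 N} (hp : p ∈ subdifferential u x₀) (hlt : F x₀ p < c - lam * u x₀)
    (hpK : ‖p‖ < K) :
    ∃ w, TorusPeriodic w ∧ LipschitzWith K w ∧ IsDiscountedSubsolution F lam c w ∧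
      u x₀ < w x₀ := by
  obtain ⟨φ, hφper, hφ, hle, rfl⟩ := hp
  have hq := contDiff_torusPenalty x₀
  have hqper := torusPeriodic_torusPenalty x₀
  set θ : (𝔼 N) → ℝ := fun y => φ y + -torusPenalty x₀ y + (u x₀ - φ x₀) with hθ_def
  have hθ : ContDiff ℝ 1 θ := (hφ.add hq.neg).add contDiff_const
  have hθper : TorusPeriodic θ := (hφper.add hqper.neg).add (TorusPeriodic.const _)
  have hθx₀ : θ x₀ = u x₀ := by simp [hθ_def]
  have hθgrad : gradient θ x₀ = gradient φ x₀ := by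
    rw [hθ_def, gradient_add_const, gradient_add (hφ.differentiable one_ne_zero _)
      (hq.neg.differentiable one_ne_zero _), gradient_neg, gradient_torusPenalty_self, neg_zero,
      add_zero]
  have hθu : ∀ y, θ y ≤ u y - torusPenalty x₀ y := fun y => by
    simp only [hθ_def]; linarith [hle y]
  -- Raising by `δ₁` uses up half of the strict gap.
  obtain ⟨δ₁, hδ₁, hδ₁'⟩ : ∃ δ > 0, F x₀ (gradient φ x₀) < c - lam * (u x₀ + δ) := by
    refine ⟨(c - lam * u x₀ - F x₀ (gradient φ x₀)) / (2 * lam), by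
      apply div_pos <;> linarith, ?_⟩
    have : lam * ((c - lam * u x₀ - F x₀ (gradient φ x₀)) / (2 * lam)) =
      (c - lam * u x₀ - F x₀ (gradient φ x₀)) / 2 := by field_simp
    rw [mul_add, this]
    linarith
  have hgc := continuous_gradient hθ
  obtain ⟨δ₂, hδ₂, hδ₂'⟩ := exists_torusPenalty_lt_imp (x₀ := x₀)
    (s := {x | F x (gradient θ x) < c - lam * (θ x + δ₁)} ∩ {x | ‖gradient θ x‖ < K})
    ((isOpen_lt (hF.comp (continuous_id.prodMk hgc)) (continuous_const.sub
      (continuous_const.mul (hθ.continuous.add continuous_const)))).inter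
      (isOpen_lt hgc.norm continuous_const))
    (by
      constructor
      · change F x₀ (gradient θ x₀) < c - lam * (θ x₀ + δ₁)
        rwa [hθgrad, hθx₀]
      · change ‖gradient θ x₀‖ < K
        rwa [hθgrad])
    (fun x z => by
      simp only [Set.mem_inter_iff, Set.mem_ofPred_eq, hFper, hθper.gradient, hθper.eq])
  -- `δ ≤ δ₂` confines the bump to the region where the strict inequalities hold; `δ ≤ δ₁` keeps the
  -- raised function a subsolution.
  set δ := min δ₁ δ₂
  have hδ : 0 < δ := lt_min hδ₁ hδ₂
  have hfd : Differentiable ℝ fun x => θ x + δ :=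
    (hθ.differentiable one_ne_zero).add_const δ
  have hmem : ∀ x, u x < θ x + δ →
      F x (gradient θ x) < c - lam * (θ x + δ₁) ∧ ‖gradient θ x‖ < K := fun x hx =>
    hδ₂' x (by linarith [hθu x, min_le_right δ₁ δ₂])
  refine ⟨fun x => max (u x) (θ x + δ), hper.max (hθper.add (TorusPeriodic.const δ)),
    hlip.max_of_norm_fderiv_le hfd fun x hx => ?_, fun x p' hp' => ?_, ?_⟩
  · rw [← norm_gradient, gradient_add_const]
    exact (hmem x hx).2.le
  · rcases le_or_gt (θ x + δ) (u x) with hx | hx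
    · have hmax : max (u x) (θ x + δ) = u x := max_eq_left hx
      simp only [hmax]
      exact hu x p' (superdifferential_subset_of_le (v := u)
        (fun y => le_max_left (u y) (θ y + δ)) hmax.symm hp')
    · have hmax : max (u x) (θ x + δ) = θ x + δ := max_eq_right hx.le
      have hp'' := eq_gradient_of_mem_superdifferential (hfd x)
        (superdifferential_subset_of_le (v := fun y => θ y + δ)
          (fun y => le_max_right (u y) (θ y + δ)) hmax.symm hp')
      rw [gradient_add_const] at hp''
      simp only [hmax, hp'']
      have := mul_le_mul_of_nonneg_left (min_le_left δ₁ δ₂) hlam.le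
      linarith [(hmem x hx).1]
  · exact lt_max_of_lt_right (by rw [hθx₀]; linarith)

theorem exists_discounted_solution (hF : Continuous (Function.uncurry F))
    (hFper : ∀ x z p, F (x + latticeVec z) p = F x p) (hF0 : ∀ x p, 0 ≤ F x p) (hlam : 0 < lam)
    {v₀ : (𝔼 N) → ℝ} (hper : TorusPeriodic v₀) (hlip : LipschitzWith K v₀)
    (hsub : IsDiscountedSubsolution F lam 0 v₀)
    (hK : ∀ x p, F x p < -(lam * v₀ x) → ‖p‖ < K) :
    ∃ u, TorusPeriodic u ∧ LipschitzWith K u ∧ (∀ x, v₀ x ≤ u x) ∧ (∀ x, u x ≤ 0) ∧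
      IsDiscountedSubsolution F lam 0 u ∧ IsDiscountedSupersolution F lam 0 u := by
  set S : Set ((𝔼 N) → ℝ) :=
    {v | TorusPeriodic v ∧ LipschitzWith K v ∧ IsDiscountedSubsolution F lam 0 v} with hS
  have hv₀ : v₀ ∈ S := ⟨hper, hlip, hsub⟩
  have hS0 : ∀ v ∈ S, ∀ x, v x ≤ 0 := fun v hv x => hv.2.2.nonpos hF0 hlam hv.1 hv.2.1.continuous x
  set u : (𝔼 N) → ℝ := fun x => sSup ((fun v => v x) '' S)
  have hu : ∀ x, IsLUB ((fun v => v x) '' S) (u x) := fun x =>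
    isLUB_csSup ⟨_, v₀, hv₀, rfl⟩ ⟨0, by rintro _ ⟨v, hv, rfl⟩; exact hS0 v hv x⟩
  have hle : ∀ v ∈ S, ∀ x, v x ≤ u x := fun v hv x => (hu x).1 ⟨v, hv, rfl⟩
  have huper : TorusPeriodic u := fun x z => by
    change sSup _ = sSup _
    congr 1
    exact Set.image_congr fun v hv => hv.1.eq x z
  have hulip : LipschitzWith K u := LipschitzWith.of_le_add_mul K fun x y => by
    refine (hu x).2 ?_
    rintro _ ⟨v, hv, rfl⟩
    exact (hv.2.1.le_add_mul x y).trans (add_le_add_left (hle v hv y) _)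
  have husub : IsDiscountedSubsolution F lam 0 u :=
    isDiscountedSubsolution_of_isLUB hF hFper (fun v hv => hv.1) (fun v hv => hv.2.1)
      (fun v hv => hv.2.2) ⟨v₀, hv₀⟩ hu
  refine ⟨u, huper, hulip, hle v₀ hv₀, fun x => (hu x).2 ?_, husub, fun x p hp => ?_⟩
  · rintro _ ⟨v, hv, rfl⟩
    exact hS0 v hv x
  · by_contra! hlt
    -- A failing test has `F x p < -λ u ≤ -λ v₀`, a level at which coercivity is available.
    have hpK : ‖p‖ < K := hK x p (by
      have := mul_le_mul_of_nonneg_left (hle v₀ hv₀ x) hlam.le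
      linarith)
    obtain ⟨w, hw1, hw2, hw3, hw4⟩ :=
      exists_bump_subsolution hF hFper hlam huper hulip husub hp hlt hpK
    exact (hle w ⟨hw1, hw2, hw3⟩ x).not_gt hw4

end Perron

/-! ### Vanishing discount. -/

section CellProblem

variable {N : ℕ}

theorem TorusPeriodic.exists_abs_le {u : (𝔼 N) → ℝ} (hu : TorusPeriodic u) (hc : Continuous u) :
    ∃ M, ∀ x, |u x| ≤ M := by
  obtain ⟨a, -, ha⟩ := TorusPeriodic.exists_forall_le (u := fun x => |u x|)
    (fun x z => by simp only [hu x z]) hc.abs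
  exact ⟨_, ha⟩

theorem LipschitzWith.of_norm_gradient_le {E : Type*} [NormedAddCommGroup E]
    [InnerProductSpace ℝ E] [CompleteSpace E] {f : E → ℝ} {K : ℝ≥0} (hf : Differentiable ℝ f)
    (h : ∀ x, ‖gradient f x‖ ≤ K) : LipschitzWith K f :=
  lipschitzWith_of_nnnorm_fderiv_le hf fun x => by
    rw [← NNReal.coe_le_coe, coe_nnnorm, ← norm_gradient]
    exact h x

theorem isDiscountedSubsolution_of_contDiff {F : (𝔼 N) → (𝔼 N) → ℝ} {lam c : ℝ}
    {v : (𝔼 N) → ℝ} (hv : Differentiable ℝ v) (h : ∀ x, F x (gradient v x) ≤ c - lam * v x) :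
    IsDiscountedSubsolution F lam c v := fun x p hp => by
  rw [eq_gradient_of_mem_superdifferential (hv x) hp]
  exact h x

/-- Solvability of the ergodic problem when some `C¹` function is a strict subsolution at a level
below which the Hamiltonian is coercive. -/
theorem exists_ergodic_solution {F : (𝔼 N) → (𝔼 N) → ℝ} {K : ℝ≥0}
    (hF : Continuous (Function.uncurry F)) (hFper : ∀ x z p, F (x + latticeVec z) p = F x p)
    (hF0 : ∀ x p, 0 ≤ F x p) {a b : ℝ} (hab : a < b) (hK : ∀ x p, F x p < b → ‖p‖ < K)
    {ψ : (𝔼 N) → ℝ} (hψper : TorusPeriodic ψ) (hψ : ContDiff ℝ 1 ψ)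
    (hψa : ∀ x, F x (gradient ψ x) ≤ a) :
    ∃ (u : (𝔼 N) → ℝ) (c : ℝ), TorusPeriodic u ∧ LipschitzWith K u ∧
      IsDiscountedSubsolution F 0 c u ∧ IsDiscountedSupersolution F 0 c u := by
  obtain ⟨M, hM⟩ := hψper.exists_abs_le hψ.continuous
  have hM0 : 0 ≤ M := (abs_nonneg _).trans (hM 0)
  have hψd := hψ.differentiable one_ne_zero
  have hψlip : LipschitzWith K ψ :=
    .of_norm_gradient_le hψd fun x => (hK x _ ((hψa x).trans_lt hab)).le
  -- Scaled so that `v₀ = ψ - M - a / λ` satisfies `a ≤ -λ v₀ ≤ a + 2 M λ ≤ b`.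
  set lam : ℕ → ℝ := fun n => (b - a) / (2 * M + 1) * (1 / ((n : ℝ) + 1)) with hlam_def
  have hlam0 : 0 < (b - a) / (2 * M + 1) := div_pos (sub_pos.2 hab) (by positivity)
  have hlam_pos : ∀ n, 0 < lam n := fun n => mul_pos hlam0 (by positivity)
  have hlam_le : ∀ n, 2 * M * lam n ≤ b - a := fun n => by
    have h1 : lam n ≤ (b - a) / (2 * M + 1) :=
      mul_le_of_le_one_right hlam0.le ((div_le_one (by positivity)).2 (by simp))
    have h2 : (b - a) / (2 * M + 1) * (2 * M + 1) = b - a := by field_simp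
    nlinarith
  have hlam : Tendsto lam atTop (𝓝 0) := by
    simpa [hlam_def] using
      (tendsto_one_div_add_atTop_nhds_zero_nat (𝕜 := ℝ)).const_mul ((b - a) / (2 * M + 1))
  have hv₀ : ∀ n x, lam n * (ψ x + -(M + a / lam n)) = lam n * ψ x - lam n * M - a := fun n x => by
    have := (hlam_pos n).ne'
    field_simp
    ring
  have hlow : ∀ n x, -(lam n * (ψ x + -(M + a / lam n))) ≤ b := fun n x => by
    have := mul_le_mul_of_nonneg_left (abs_le.1 (hM x)).1 (hlam_pos n).le
    linarith [hv₀ n x, hlam_le n]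
  have hsol := fun n => exists_discounted_solution hF hFper hF0 (hlam_pos n)
    (v₀ := fun x => ψ x + -(M + a / lam n)) (hψper.add (.const _))
    (by simpa using hψlip.add (LipschitzWith.const (α := 𝔼 N) (-(M + a / lam n))))
    (isDiscountedSubsolution_of_contDiff (hψd.add_const _) fun x => by
      rw [gradient_add_const, hv₀]
      have := mul_le_mul_of_nonneg_left (abs_le.1 (hM x)).2 (hlam_pos n).le
      linarith [hψa x])
    (fun x p h => hK x p (h.trans_le (hlow n x)))
  choose u huper hulip hule hu0 husub husup using hsol
  set U : Ultrafilter ℕ := hyperfilter ℕ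
  obtain ⟨c, -, hc⟩ := U.exists_tendsto_of_mem_compact (isCompact_Icc (a := 0) (b := b))
    (f := fun n => -(lam n * u n 0)) fun n => by
      have h1 := mul_nonpos_of_nonneg_of_nonpos (hlam_pos n).le (hu0 n 0)
      have h2 := mul_le_mul_of_nonneg_left (hule n 0) (hlam_pos n).le
      exact ⟨by linarith, by linarith [hlow n 0]⟩
  have hlim : ∀ x, ∃ r, Tendsto (fun n => u n x + -u n 0) U (𝓝 r) := fun x => by
    obtain ⟨r, -, hr⟩ := U.exists_tendsto_of_mem_compact
      (isCompact_Icc (a := -(K * dist x 0)) (b := K * dist x 0))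
      (f := fun n => u n x + -u n 0) fun n => by
        rw [Set.mem_Icc, ← abs_le, ← sub_eq_add_neg, ← Real.dist_eq]
        exact (hulip n).dist_le_mul x 0
    exact ⟨r, hr⟩
  choose w hw using hlim
  have hwper : ∀ n, TorusPeriodic fun x => u n x + -u n 0 := fun n => (huper n).add (.const _)
  have hwlip : ∀ n, LipschitzWith K fun x => u n x + -u n 0 := fun n => by
    simpa using (hulip n).add (LipschitzWith.const (α := 𝔼 N) (-u n 0))
  have hlamU : Tendsto lam U (𝓝 0) := hlam.mono_left Nat.hyperfilter_le_atTop
  refine ⟨w, c, .of_tendsto hwper hw, LipschitzWith.of_le_add_mul K fun x y => ?_, ?_, ?_⟩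
  · exact le_of_tendsto_of_tendsto' (hw x) ((hw y).add_const _) fun n => (hwlip n).le_add_mul x y
  · refine .of_tendsto U hF hFper hwper hwlip (fun n => ?_) hw hlamU hc
    -- Subtracting `u n 0` leaves the test functions unchanged and moves `-λ u n 0` into the
    -- right-hand side.
    rintro x p ⟨φ, h1, h2, h3, h4⟩
    linarith [husub n x p ⟨φ, h1, h2, fun y => by linarith [h3 y], h4⟩]
  · refine .of_tendsto U hF hFper hwper hwlip (fun n => ?_) hw hlamU hc
    rintro x p ⟨φ, h1, h2, h3, h4⟩
    linarith [husup n x p ⟨φ, h1, h2, fun y => by linarith [h3 y], h4⟩]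

end CellProblem

/-! ### The cell problem at `P`. -/

theorem theorem3p6 {N : ℕ}
    (σ : EuclideanSpace ℝ (Fin N) → ℝ) (m : ℝ≥0 → ℝ)
    (hσ_per : TorusPeriodic σ) (hσ_cont : Continuous σ) (hσ_pos : ∀ x, 0 < σ x)
    (hm_range : ∀ r, m r ∈ Set.Ioo (0 : ℝ) 1) (hm_lip : ∃ K : ℝ≥0, LipschitzWith K m)
    (hm_mono : StrictMono m) (hm_lim : Tendsto m atTop (𝓝 1))
    (h_lt : (⨆ x, σ x) * m 0 < ⨅ x, σ x)
    (P : EuclideanSpace ℝ (Fin N))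
    (hψ : ∃ ψ : EuclideanSpace ℝ (Fin N) → ℝ, TorusPeriodic ψ ∧ ContDiff ℝ 1 ψ ∧
      ∀ x, σ x ≠ ⨅ y, σ y → gradient ψ x = -P) :
    P ∈ solvabilitySet (fun x p => σ x * m ‖p‖₊) := by
  obtain ⟨ψ, hψper, hψ, hψP⟩ := hψ
  obtain ⟨Km, hKm⟩ := hm_lip
  set s := ⨅ x, σ x
  have hs_le : ∀ x, s ≤ σ x := ciInf_le ⟨0, by rintro _ ⟨x, rfl⟩; exact (hσ_pos x).le⟩
  obtain ⟨M, hM⟩ := hσ_per.exists_abs_le hσ_cont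
  have hle_sup : ∀ x, σ x ≤ ⨆ y, σ y :=
    le_ciSup ⟨M, by rintro _ ⟨x, rfl⟩; exact (le_abs_self _).trans (hM x)⟩
  have hs : 0 < s :=
    (mul_pos ((hσ_pos 0).trans_le (hle_sup 0)) (hm_range 0).1).trans h_lt
  have hgc : Continuous fun x => ‖gradient ψ x + P‖ :=
    ((continuous_gradient hψ).add continuous_const).norm
  obtain ⟨x₁, -, hx₁⟩ := TorusPeriodic.exists_forall_le (u := fun x => ‖gradient ψ x + P‖)
    (fun x z => by
      change ‖gradient ψ (x + latticeVec z) + P‖ = _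
      rw [hψper.gradient]) hgc
  set a := max ((⨆ x, σ x) * m 0) (s * m ‖gradient ψ x₁ + P‖₊)
  have has : a < s := max_lt h_lt (mul_lt_of_lt_one_right hs (hm_range _).2)
  obtain ⟨b, hab, hbs⟩ := exists_between has
  -- `m R > b / s`, so `H < b` forces `|p + P| < R`, hence `|p| < R + |P|`.
  obtain ⟨R, hR⟩ := (hm_lim.eventually (lt_mem_nhds ((div_lt_one hs).2 hbs))).exists
  rw [div_lt_iff₀ hs] at hR
  obtain ⟨u, c, huper, hulip, husub, husup⟩ := exists_ergodic_solution
    (F := fun x p => σ x * m ‖p + P‖₊) (K := R + ‖P‖₊)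
    ((hσ_cont.comp continuous_fst).mul (hKm.continuous.comp
      (continuous_snd.add continuous_const).nnnorm))
    (fun x z p => by rw [hσ_per.eq]) (fun x p => (mul_pos (hσ_pos x) (hm_range _).1).le) hab
    (fun x p hp => by
      have h1 : s * m ‖p + P‖₊ < s * m R := by
        linarith [mul_le_mul_of_nonneg_right (hs_le x) (hm_range ‖p + P‖₊).1.le]
      have h2 : ‖p + P‖₊ < R := hm_mono.lt_iff_lt.1 (lt_of_mul_lt_mul_left h1 hs.le)
      have h3 : ‖p + P‖ < R := h2
      have h4 : ‖p‖ ≤ ‖p + P‖ + ‖P‖ := by simpa using norm_sub_le (p + P) P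
      push_cast
      linarith)
    hψper hψ (fun x => by
      by_cases hx : σ x = s
      · refine le_max_of_le_right ?_
        simp only [hx]
        exact mul_le_mul_of_nonneg_left (hm_mono.monotone (hx₁ x)) hs.le
      · refine le_max_of_le_left ?_
        simp only [hψP x hx, neg_add_cancel, nnnorm_zero]
        exact mul_le_mul_of_nonneg_right (hle_sup x) (hm_range 0).1.le)
  refine ⟨u, c, ⟨_, hulip⟩, ⟨huper, hulip.continuous, fun x p hp => ?_⟩,
    huper, hulip.continuous, fun x p hp => ?_⟩
  · linarith [husub x p hp]
  · linarith [husup x p hp]
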